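/- Let $X$ be a complex Banach space and $A,B\in B(X)$. For $C\in B(X)$ let $M_C=\begin{pmatrix}A&C\\0&B\end{pmatrix}$ on $X\oplus X$, so $M_0=A\oplus B$. For a Banach space operator $T$, with Banach space adjoint $T^*$, let $\sigma(T)$ be the spectrum, $\mathrm{iso}\,\sigma(T)$ the set of its isolated points, and $\pi_0(T)=\{\lambda\in\mathrm{iso}\,\sigma(T):0<\dim\ker(T-\lambda)<\infty\}$. Let $\sigma_{SF_+}(T)$ (resp. $\sigma_{SF_-}(T)$) be the set of $\lambda\in\mathbb C$ for which it is not true that $T-\lambda$ has closed range and finite-dimensional kernel (resp. closed range of finite codimension), and let $\sigma_w(T)$ be the set of $\lambda$ for which $T-\lambda$ is not a Fredholm operator of index $0$. The operator $T$ satisfies Weyl's theorem if $\sigma(T)\setminus\sigma_w(T)=\pi_0(T)$. It is polaroid at $\lambda$ if the ascent and the descent of $T-\lambda$ are finite and equal (which holds trivially if $\lambda\notin\sigma(T)$); it is polaroid if it is polaroid at every $\lambda\in\mathrm{iso}\,\sigma(T)$, and isoloid if every $\lambda\in\mathrm{iso}\,\sigma(T)$ is an eigenvalue of $T$. It has SVEP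 at $\lambda_0$ if, for every open disc $D$ centred at $\lambda_0$, the only analytic function $f$ on $D$ with $(T-\lambda)f(\lambda)=0$ for all $\lambda\in D$ is $f\equiv0$. Assume that one of the following holds: (i) $A$ has SVEP at every point of $\sigma_w(M_0)\setminus\sigma_{SF_+}(A)$ and $B$ has SVEP at every point of $\sigma_w(M_0)\setminus\sigma_{SF_-}(B)$; (ii) both $A$ and $A^*$ have SVEP at every point of $\sigma_w(M_0)\setminus\sigma_{SF_+}(A)$; (iii) $A^*$ has SVEP at every point of $\sigma_w(M_0)\setminus\sigma_{SF_+}(A)$ and $B^*$ has SVEP at every point of $\sigma_w(M_0)\setminus\sigma_{SF_-}(B)$. Then: (1) $M_C$ satisfies Weyl's theorem for every $C\in B(X)$ if and only if $M_0$ satisfies Weyl's theorem and, for every $C\in B(X)$, $A$ is polaroid at every $\lambda\in\pi_0(M_C)$. (2) For each single $C\in B(X)$: if $M_0$ satisfies Weyl's theorem and $A$ is polaroid at every $\lambda\in\pi_0(M_C)$, then $M_C$ satisfies Weyl's theorem. (3) If $M_0$ satisfies Weyl's theorem and either $A$ is polaroid, or $A$ is isoloid and satisfies Weyl's theorem, then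 $M_C$ satisfies Weyl's theorem for every $C\in B(X)$. -/

import Mathlib

open Set Filter Topology

namespace WeylOp

section Operator

variable {Y : Type*} [NormedAddCommGroup Y] [NormedSpace ℂ Y]

/-- The operator `T - z`. -/
def shift (T : Y →L[ℂ] Y) (z : ℂ) : Y →L[ℂ] Y :=
  T - z • ContinuousLinearMap.id ℂ Y

/-- Upper semi-Fredholm operators: closed range and finite-dimensional kernel. -/
def IsUpperSemiFredholm (S : Y →L[ℂ] Y) : Prop :=
  IsClosed (S.range : Set Y) ∧ FiniteDimensional ℂ S.ker

/-- Lower semi-Fredholm operators: closed range of finite codimension. -/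
def IsLowerSemiFredholm (S : Y →L[ℂ] Y) : Prop :=
  IsClosed (S.range : Set Y) ∧ FiniteDimensional ℂ (Y ⧸ S.range)

/-- The index `α(S) - β(S)`. It is only used for Fredholm operators, where both dimensions
are finite. -/
noncomputable def index (S : Y →L[ℂ] Y) : ℤ :=
  (Module.finrank ℂ S.ker : ℤ) - (Module.finrank ℂ (Y ⧸ S.range) : ℤ)

/-- Weyl operators: Fredholm (that is, upper and lower semi-Fredholm) of index zero. -/
def IsWeyl (S : Y →L[ℂ] Y) : Prop :=
  IsUpperSemiFredholm S ∧ IsLowerSemiFredholm S ∧ index S = 0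

/-- The upper semi-Fredholm spectrum. -/
def upperSemiFredholmSpectrum (T : Y →L[ℂ] Y) : Set ℂ :=
  {z | ¬ IsUpperSemiFredholm (shift T z)}

/-- The lower semi-Fredholm spectrum. -/
def lowerSemiFredholmSpectrum (T : Y →L[ℂ] Y) : Set ℂ :=
  {z | ¬ IsLowerSemiFredholm (shift T z)}

/-- The Weyl spectrum. -/
def weylSpectrum (T : Y →L[ℂ] Y) : Set ℂ :=
  {z | ¬ IsWeyl (shift T z)}

/-- The set of isolated points of the spectrum. -/
def isoSpectrum (T : Y →L[ℂ] Y) : Set ℂ :=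
  {z | z ∈ spectrum ℂ T ∧ ∃ U ∈ 𝓝 z, U ∩ spectrum ℂ T = {z}}

/-- The isolated points of the spectrum that are eigenvalues of finite multiplicity. -/
def piZero (T : Y →L[ℂ] Y) : Set ℂ :=
  {z | z ∈ isoSpectrum T ∧ (shift T z).ker ≠ ⊥ ∧ FiniteDimensional ℂ (shift T z).ker}

/-- Weyl's theorem holds for `T`. -/
def SatisfiesWeyl (T : Y →L[ℂ] Y) : Prop :=
  spectrum ℂ T \ weylSpectrum T = piZero T

/-- The ascent: the least `n` with `ker Sⁿ = ker Sⁿ⁺¹`, and `⊤` if there is none. -/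
noncomputable def ascent (S : Y →L[ℂ] Y) : ℕ∞ :=
  sInf ((fun n : ℕ => (n : ℕ∞)) '' {n : ℕ | (S ^ n).ker = (S ^ (n + 1)).ker})

/-- The descent: the least `n` with `ran Sⁿ = ran Sⁿ⁺¹`, and `⊤` if there is none. -/
noncomputable def descent (S : Y →L[ℂ] Y) : ℕ∞ :=
  sInf ((fun n : ℕ => (n : ℕ∞)) '' {n : ℕ | (S ^ n).range = (S ^ (n + 1)).range})

/-- `T` is polaroid at `z`: ascent and descent of `T - z` are finite and equal. At a point of the
resolvent set this holds trivially, both being zero. -/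
def PolaroidAt (T : Y →L[ℂ] Y) (z : ℂ) : Prop :=
  ascent (shift T z) = descent (shift T z) ∧ ascent (shift T z) < ⊤

/-- `T` is polaroid at every isolated point of its spectrum. -/
def Polaroid (T : Y →L[ℂ] Y) : Prop :=
  ∀ z ∈ isoSpectrum T, PolaroidAt T z

/-- Every isolated point of the spectrum of `T` is an eigenvalue of `T`. -/
def Isoloid (T : Y →L[ℂ] Y) : Prop :=
  ∀ z ∈ isoSpectrum T, (shift T z).ker ≠ ⊥

/-- The single-valued extension property of `T` at `z₀`. -/
def HasSVEPAt (T : Y →L[ℂ] Y) (z₀ : ℂ) : Prop :=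
  ∀ r : ℝ, 0 < r → ∀ f : ℂ → Y, AnalyticOnNhd ℂ f (Metric.ball z₀ r) →
    (∀ z ∈ Metric.ball z₀ r, shift T z (f z) = 0) → ∀ z ∈ Metric.ball z₀ r, f z = 0

/-- The Banach space adjoint `T* : Y* → Y*`, `φ ↦ φ ∘ T`. -/
noncomputable def dualOp (T : Y →L[ℂ] Y) : StrongDual ℂ Y →L[ℂ] StrongDual ℂ Y :=
  ContinuousLinearMap.precomp ℂ T

end Operator

section Matrix

variable {X : Type*} [NormedAddCommGroup X] [NormedSpace ℂ X]

/-- The upper triangular operator matrix `M_C` on `X ⊕ X`,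
`(x, y) ↦ (A x + C y, B y)`. Thus `opMatrix A B 0` is `A ⊕ B`. -/
def opMatrix (A B C : X →L[ℂ] X) : (X × X) →L[ℂ] (X × X) :=
  (A.coprod C).prod (B.comp (ContinuousLinearMap.snd ℂ X X))

/-- `A` has SVEP on `σ_w(A ⊕ B) \ σ_{SF₊}(A)` and `B` has SVEP on `σ_w(A ⊕ B) \ σ_{SF₋}(B)`. -/
def SVEPHypI (A B : X →L[ℂ] X) : Prop :=
  (∀ z ∈ weylSpectrum (opMatrix A B 0) \ upperSemiFredholmSpectrum A, HasSVEPAt A z) ∧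
  (∀ z ∈ weylSpectrum (opMatrix A B 0) \ lowerSemiFredholmSpectrum B, HasSVEPAt B z)

/-- Both `A` and `A*` have SVEP on `σ_w(A ⊕ B) \ σ_{SF₊}(A)`. -/
def SVEPHypII (A B : X →L[ℂ] X) : Prop :=
  ∀ z ∈ weylSpectrum (opMatrix A B 0) \ upperSemiFredholmSpectrum A,
    HasSVEPAt A z ∧ HasSVEPAt (dualOp A) z

/-- `A*` has SVEP on `σ_w(A ⊕ B) \ σ_{SF₊}(A)` and `B*` has SVEP on
`σ_w(A ⊕ B) \ σ_{SF₋}(B)`. -/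
def SVEPHypIII (A B : X →L[ℂ] X) : Prop :=
  (∀ z ∈ weylSpectrum (opMatrix A B 0) \ upperSemiFredholmSpectrum A, HasSVEPAt (dualOp A) z) ∧
  (∀ z ∈ weylSpectrum (opMatrix A B 0) \ lowerSemiFredholmSpectrum B, HasSVEPAt (dualOp B) z)

end Matrix

end WeylOp

open WeylOp

/-! Write `α`, `β` for the dimensions of kernel and cokernel. Everything rests on the exact sequence
`0 → ker A → ker M_C → ker B → coker A → coker M_C → coker B → 0`, applied to `A - z` and `B - z`.
When both are Fredholm, `M_C - z` is Fredholm with an index independent of `C`.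

If `M_C - z` is Weyl, then `A - z` is upper and `B - z` lower semi-Fredholm, and it remains to bound
`ker (B - z)` or `coker (A - z)`, since the sequence yields one from the other. SVEP of `B` gives `α
≤ β` for `B - z` (`HasSVEPAt.finrank_ker_le`); SVEP of `A*` gives `β ≤ α` for `A - z`
(`HasSVEPAt.finrank_coker_le`). Hence `M_C` and `M_0` have the same Weyl spectrum and, if `M_0`
satisfies Weyl's theorem, the same spectrum.

Weyl's theorem for `M_C` then amounts to `π₀(M_C) = π₀(M_0)`. The inclusion that can fail needs `ker
(B - z)` finite-dimensional for `z ∈ π₀(M_C)`; finite descent of `A - z` makes `coker (A - z)`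
finite-dimensional, and the sequence does the rest. Conversely, a Fredholm `A - z` with `z` not an
accumulation point of `σ(A)` has finite equal ascent and descent (`index_eq_zero_and_polaroidAt`).
-/

namespace WeylOp

/-! ### Exact sequences, powers of Fredholm maps, ascent and descent. -/

section LinearAlgebra

open Function Module

variable {K : Type*} [Field K]

theorem finiteDimensional_of_exact {V₁ V₂ V₃ : Type*} [AddCommGroup V₁] [Module K V₁]
    [AddCommGroup V₂] [Module K V₂] [AddCommGroup V₃] [Module K V₃]
    {f : V₁ →ₗ[K] V₂} {g : V₂ →ₗ[K] V₃} (h : Exact f g)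
    [FiniteDimensional K V₁] [FiniteDimensional K V₃] : FiniteDimensional K V₂ :=
  IsNoetherian.iff_fg.1
    (isNoetherian_of_range_eq_ker f g (LinearMap.exact_iff.1 h).symm)

variable {V W : Type*} [AddCommGroup V] [Module K V] [AddCommGroup W] [Module K W]

/-- The kernel-cokernel sequence of an upper triangular matrix of linear maps. -/
theorem exists_exact_triangular (A : V →ₗ[K] V) (C : W →ₗ[K] V) (B : W →ₗ[K] W)
    (M : (V × W) →ₗ[K] V × W) (hM : ∀ x y, M (x, y) = (A x + C y, B y)) :
    ∃ (f₀ : A.ker →ₗ[K] M.ker) (f₁ : M.ker →ₗ[K] B.ker) (f₂ : B.ker →ₗ[K] V ⧸ A.range)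
      (f₃ : (V ⧸ A.range) →ₗ[K] (V × W) ⧸ M.range) (f₄ : ((V × W) ⧸ M.range) →ₗ[K] W ⧸ B.range),
      Injective f₀ ∧ Exact f₀ f₁ ∧ Exact f₁ f₂ ∧ Exact f₂ f₃ ∧ Exact f₃ f₄ ∧ Surjective f₄ := by
  have h₀ : ∀ x ∈ A.ker, LinearMap.inl K V W x ∈ M.ker := fun x hx => by
    simpa [hM] using hx
  have h₁ : ∀ p ∈ M.ker, LinearMap.snd K V W p ∈ B.ker := fun p hp => by
    obtain ⟨x, y⟩ := p
    simp only [LinearMap.mem_ker, hM, Prod.mk_eq_zero] at hp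
    exact hp.2
  have h₃ : A.range ≤ M.range.comap (LinearMap.inl K V W) := by
    rintro _ ⟨x, rfl⟩
    exact ⟨(x, 0), by simp [hM]⟩
  have h₄ : M.range ≤ B.range.comap (LinearMap.snd K V W) := by
    rintro _ ⟨⟨x, y⟩, rfl⟩
    exact ⟨y, by simp [hM]⟩
  -- The connecting map is induced by `C`: for `B y = 0`, some `(x, y)` lies in `ker M` iff `C y ∈
  -- ran A`.
  refine ⟨(LinearMap.inl K V W).restrict h₀, (LinearMap.snd K V W).restrict h₁,
    A.range.mkQ ∘ₗ C ∘ₗ B.ker.subtype, A.range.mapQ _ _ h₃, M.range.mapQ _ _ h₄, ?_, ?_, ?_, ?_,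
    ?_, ?_⟩
  · rintro ⟨x, hx⟩ ⟨y, hy⟩ h
    simpa [Subtype.ext_iff] using h
  · rintro ⟨⟨x, y⟩, hp⟩
    simp only [LinearMap.mem_ker, hM, Prod.mk_eq_zero] at hp
    constructor
    · intro h
      have hy : y = 0 := by simpa [Subtype.ext_iff] using h
      subst hy
      exact ⟨⟨x, by simpa using hp.1⟩, by simp [Subtype.ext_iff]⟩
    · rintro ⟨⟨x', hx'⟩, h⟩
      have : x' = x ∧ 0 = y := by simpa [Subtype.ext_iff] using h
      simp [Subtype.ext_iff, ← this.2]
  · rintro ⟨y, hy⟩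
    have hy' : B y = 0 := hy
    simp only [LinearMap.comp_apply, Submodule.subtype_apply, Submodule.mkQ_apply,
      Submodule.Quotient.mk_eq_zero]
    constructor
    · rintro ⟨x, hx⟩
      exact ⟨⟨(-x, y), by simp [hM, hx, hy']⟩, rfl⟩
    · rintro ⟨⟨⟨x, y'⟩, hp⟩, h⟩
      simp only [LinearMap.mem_ker, hM, Prod.mk_eq_zero] at hp
      have : y' = y := by simpa [Subtype.ext_iff] using h
      subst this
      exact ⟨-x, by rw [map_neg, neg_eq_iff_add_eq_zero]; exact hp.1⟩
  · intro q
    obtain ⟨v, rfl⟩ := Submodule.Quotient.mk_surjective _ q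
    simp only [Submodule.mapQ_apply, LinearMap.inl_apply, Submodule.Quotient.mk_eq_zero]
    constructor
    · rintro ⟨⟨x, y⟩, h⟩
      simp only [hM, Prod.mk.injEq] at h
      refine ⟨⟨y, h.2⟩, ?_⟩
      simp only [LinearMap.comp_apply, Submodule.subtype_apply, Submodule.mkQ_apply]
      rw [Submodule.Quotient.eq, ← h.1]
      exact ⟨-x, by simp⟩
    · rintro ⟨⟨y, hy⟩, h⟩
      have hy' : B y = 0 := hy
      simp only [LinearMap.comp_apply, Submodule.subtype_apply, Submodule.mkQ_apply] at h
      rw [Submodule.Quotient.eq] at h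
      obtain ⟨x, hx⟩ := h
      exact ⟨(-x, y), by simp [hM, hx, hy']⟩
  · intro q
    obtain ⟨⟨v, w⟩, rfl⟩ := Submodule.Quotient.mk_surjective _ q
    simp only [Submodule.mapQ_apply, LinearMap.snd_apply, Submodule.Quotient.mk_eq_zero]
    constructor
    · rintro ⟨y, rfl⟩
      refine ⟨Submodule.Quotient.mk (v - C y), ?_⟩
      rw [Submodule.mapQ_apply, Submodule.Quotient.eq]
      exact ⟨(0, -y), by simp [hM]⟩
    · rintro ⟨q, h⟩
      obtain ⟨v', rfl⟩ := Submodule.Quotient.mk_surjective _ q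
      rw [Submodule.mapQ_apply, Submodule.Quotient.eq] at h
      obtain ⟨⟨x, y⟩, h⟩ := h
      simp only [hM, LinearMap.inl_apply, Prod.mk_sub_mk, Prod.mk.injEq] at h
      exact ⟨-y, by simp [h.2]⟩
  · intro q
    obtain ⟨w, rfl⟩ := Submodule.Quotient.mk_surjective _ q
    exact ⟨Submodule.Quotient.mk (0, w), by simp⟩

theorem finiteDimensional_ker_coker_pow (S : V →ₗ[K] V) [FiniteDimensional K S.ker]
    [FiniteDimensional K (V ⧸ S.range)] (n : ℕ) :
    FiniteDimensional K (S ^ n).ker ∧ FiniteDimensional K (V ⧸ (S ^ n).range) ∧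
      (S ^ n).index = n * S.index := by
  induction n with
  | zero =>
    rw [pow_zero, Module.End.one_eq_id, LinearMap.ker_id, LinearMap.range_id]
    exact ⟨inferInstance, inferInstance, by simp⟩
  | succ n ih =>
    obtain ⟨h₁, h₂, h₃⟩ := ih
    have h : S ^ (n + 1) = S ∘ₗ S ^ n := by rw [pow_succ', Module.End.mul_eq_comp]
    refine ⟨?_, ?_, ?_⟩
    · rw [h, LinearMap.ker_comp]; infer_instance
    · rw [h, LinearMap.range_comp]; infer_instance
    · rw [h, LinearMap.index_comp, h₃]; push_cast; ring

theorem _root_.Submodule.eq_of_le_of_finrank_quotient_eq {P Q : Submodule K V}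
    [FiniteDimensional K (V ⧸ P)] (h : P ≤ Q) (hf : finrank K (V ⧸ P) = finrank K (V ⧸ Q)) :
    P = Q := by
  have hs : Surjective (Submodule.factor h) := Submodule.factor_surjective h
  have : FiniteDimensional K (V ⧸ Q) := Module.Finite.of_surjective _ hs
  have hi : Injective (Submodule.factor h) :=
    (LinearMap.injective_iff_surjective_of_finrank_eq_finrank hf).2 hs
  refine le_antisymm h fun x hx => ?_
  rw [← Submodule.Quotient.mk_eq_zero P]
  apply hi
  rw [map_zero]
  exact (Submodule.Quotient.mk_eq_zero Q).2 hx

/-- All powers of `S` have index zero, so the kernel dimension stalls exactly when the codimension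
of the range does. -/
theorem ker_pow_eq_iff_range_pow_eq (S : V →ₗ[K] V) [FiniteDimensional K S.ker]
    [FiniteDimensional K (V ⧸ S.range)] (hS : S.index = 0) (n : ℕ) :
    (S ^ n).ker = (S ^ (n + 1)).ker ↔ (S ^ n).range = (S ^ (n + 1)).range := by
  obtain ⟨h₁, h₂, h₃⟩ := finiteDimensional_ker_coker_pow S n
  obtain ⟨k₁, k₂, k₃⟩ := finiteDimensional_ker_coker_pow S (n + 1)
  rw [hS, mul_zero, LinearMap.index_eq_finrank_sub] at h₃ k₃
  constructor
  · intro h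
    rw [h] at h₃
    refine (Submodule.eq_of_le_of_finrank_quotient_eq ?_ (by omega)).symm
    rw [pow_succ, Module.End.mul_eq_comp]
    exact LinearMap.range_comp_le_range _ _
  · intro h
    rw [h] at h₃
    refine Submodule.eq_of_le_of_finrank_eq ?_ (by omega)
    rw [pow_succ', Module.End.mul_eq_comp]
    exact LinearMap.ker_le_ker_comp _ _

/-- A linear map with finite-dimensional kernel and finite descent has a range of finite
codimension. -/
theorem finiteDimensional_coker_of_range_pow_eq (S : V →ₗ[K] V) [FiniteDimensional K S.ker]
    {n : ℕ} (hn : (S ^ n).range = (S ^ (n + 1)).range) : FiniteDimensional K (V ⧸ S.range) := by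
  have hker : ∀ m : ℕ, FiniteDimensional K (S ^ m).ker := fun m => by
    induction m with
    | zero => rw [pow_zero, Module.End.one_eq_id, LinearMap.ker_id]; infer_instance
    | succ m ih => rw [pow_succ', Module.End.mul_eq_comp, LinearMap.ker_comp]; infer_instance
  have hdesc : ∀ x, ∃ y, (S ^ n) x = (S ^ (n + 1)) y := fun x => by
    obtain ⟨y, hy⟩ := (hn ▸ ⟨x, rfl⟩ : (S ^ n) x ∈ (S ^ (n + 1)).range)
    exact ⟨y, hy.symm⟩
  -- Finite descent gives `V = ran S + ker Sⁿ`, so the finite-dimensional `ker Sⁿ` maps onto `coker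
  -- S`.
  have := hker n
  refine Module.Finite.of_surjective (S.range.mkQ ∘ₗ (S ^ n).ker.subtype) fun q => ?_
  obtain ⟨x, rfl⟩ := Submodule.Quotient.mk_surjective _ q
  obtain ⟨y, hy⟩ := hdesc x
  refine ⟨⟨x - S y, ?_⟩, ?_⟩
  · rw [LinearMap.mem_ker, map_sub, hy, pow_succ, Module.End.mul_apply, sub_self]
  · simp only [LinearMap.comp_apply, Submodule.subtype_apply, Submodule.mkQ_apply]
    rw [Submodule.Quotient.eq]
    exact ⟨-y, by simp⟩

end LinearAlgebra

/-! ### Power series of kernel vectors. -/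

section Analytic

/-- Kernel vectors of a surjective operator `G` extend to analytic families of kernel vectors of
`G - z J`, on a disc that does not depend on the vector. -/
theorem exists_analytic_kernel {E F : Type*} [NormedAddCommGroup E] [NormedSpace ℂ E]
    [CompleteSpace E] [NormedAddCommGroup F] [NormedSpace ℂ F] [CompleteSpace F]
    (G J : E →L[ℂ] F) (hG : Function.Surjective G) :
    ∃ r > 0, ∀ e₀, G e₀ = 0 → ∃ e : ℂ → E, AnalyticOnNhd ℂ e (Metric.ball 0 r) ∧ e 0 = e₀ ∧
      ∀ z ∈ Metric.ball (0 : ℂ) r, G (e z) = z • J (e z) := by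
  obtain ⟨c, hc, hpre⟩ := G.exists_preimage_norm_le hG
  choose g hg hgn using hpre
  -- The `+ 1` only keeps `k` positive when `J = 0`.
  set k : ℝ := c * ‖J‖ + 1 with hk
  have hk0 : 0 < k := by positivity
  refine ⟨1 / (2 * k), by positivity, fun e₀ he₀ => ?_⟩
  -- Comparing coefficients in `G e(z) = z J e(z)` asks for `G aₙ₊₁ = J aₙ`. The bounded, possibly
  -- nonlinear, right inverse `g` of `G` solves this with `‖aₙ‖ ≤ kⁿ ‖e₀‖`.
  let a : ℕ → E := fun n => (fun x => g (J x))^[n] e₀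
  have ha : ∀ n, G (a (n + 1)) = J (a n) := fun n => by
    simp only [a, Function.iterate_succ_apply', hg]
  have han : ∀ n, ‖a n‖ ≤ k ^ n * ‖e₀‖ := fun n => by
    induction n with
    | zero => simp [a]
    | succ n ih =>
      have h1 : ‖a (n + 1)‖ ≤ c * ‖J (a n)‖ := by
        simp only [a, Function.iterate_succ_apply']; exact hgn _
      calc ‖a (n + 1)‖ ≤ c * ‖J (a n)‖ := h1
        _ ≤ c * (‖J‖ * ‖a n‖) := by gcongr; exact J.le_opNorm _
        _ = (c * ‖J‖) * ‖a n‖ := by ring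
        _ ≤ k * (k ^ n * ‖e₀‖) := by gcongr; rw [hk]; linarith
        _ = k ^ (n + 1) * ‖e₀‖ := by ring
  have hbound : ∀ n, ∀ z ∈ Metric.ball (0 : ℂ) (1 / (2 * k)),
      ‖z ^ n • a n‖ ≤ (1 / 2) ^ n * ‖e₀‖ := fun n z hz => by
    have hz' : ‖z‖ ≤ 1 / (2 * k) := by
      rw [mem_ball_zero_iff] at hz; exact hz.le
    rw [norm_smul, norm_pow]
    calc ‖z‖ ^ n * ‖a n‖ ≤ (1 / (2 * k)) ^ n * (k ^ n * ‖e₀‖) := by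
          gcongr; exact han n
      _ = (1 / (2 * k) * k) ^ n * ‖e₀‖ := by rw [mul_pow]; ring
      _ = (1 / 2) ^ n * ‖e₀‖ := by congr 2; field_simp
  have hsum : Summable fun n : ℕ => (1 / 2 : ℝ) ^ n * ‖e₀‖ :=
    (summable_geometric_of_lt_one (by norm_num) (by norm_num)).mul_right _
  have hs : ∀ z ∈ Metric.ball (0 : ℂ) (1 / (2 * k)), Summable fun n => z ^ n • a n :=
    fun z hz => Summable.of_norm_bounded hsum fun n => hbound n z hz
  refine ⟨fun z => ∑' n, z ^ n • a n, ?_, ?_, fun z hz => ?_⟩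
  · refine DifferentiableOn.analyticOnNhd ?_ Metric.isOpen_ball
    refine Complex.differentiableOn_tsum_of_summable_norm hsum (fun n => ?_) Metric.isOpen_ball
      hbound
    fun_prop
  · change ∑' n, (0 : ℂ) ^ n • a n = e₀
    rw [tsum_eq_single 0 fun n hn => by rw [zero_pow hn, zero_smul]]
    simp [a]
  · have h1 := hs z hz
    rw [G.map_tsum h1, J.map_tsum h1, ← tsum_const_smul'' z,
      (h1.mapL G).tsum_eq_zero_add]
    simp only [map_smul, ha, a, Function.iterate_zero, id, he₀, smul_zero, zero_add, pow_succ',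
      mul_smul]

end Analytic

/-! ### SVEP bounds the kernel by the cokernel. -/

section SVEP

variable {Y : Type*} [NormedAddCommGroup Y] [NormedSpace ℂ Y]

theorem shift_add_apply (T : Y →L[ℂ] Y) (z w : ℂ) (y : Y) :
    shift T (z + w) y = shift T z y - w • y := by
  simp only [shift, sub_apply, smul_apply,
    ContinuousLinearMap.id_apply, add_smul, add_apply]
  abel

theorem HasSVEPAt.eq_zero {T : Y →L[ℂ] Y} {z₀ : ℂ} (h : HasSVEPAt T z₀) {r : ℝ} (hr : 0 < r)
    {f : ℂ → Y} (hf : AnalyticOnNhd ℂ f (Metric.ball 0 r))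
    (hT : ∀ w ∈ Metric.ball (0 : ℂ) r, shift T z₀ (f w) = w • f w) :
    ∀ w ∈ Metric.ball (0 : ℂ) r, f w = 0 := by
  have hmem : ∀ z, z ∈ Metric.ball z₀ r ↔ z - z₀ ∈ Metric.ball 0 r := fun z => by
    rw [Metric.mem_ball, dist_eq_norm, mem_ball_zero_iff]
  have key := h r hr (fun z => f (z - z₀))
    (fun z hz => by
      have h1 : AnalyticAt ℂ f (z - z₀) := hf _ ((hmem z).1 hz)
      have h2 : AnalyticAt ℂ (fun z => z - z₀) z := analyticAt_id.sub analyticAt_const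
      exact AnalyticAt.fun_comp h1 h2)
    (fun z hz => by
      have h1 := hT _ ((hmem z).1 hz)
      have h2 := shift_add_apply T z₀ (z - z₀) (f (z - z₀))
      rw [add_sub_cancel, h1, sub_self] at h2
      exact h2)
  intro w hw
  have := key (z₀ + w) ((hmem _).2 (by simpa using hw))
  simpa using this

/-- The ring of functions on a disc that are restrictions of analytic functions. -/
def analyticRing (r : ℝ) : Subring (Metric.ball (0 : ℂ) r → ℂ) where
  carrier := {f | ∃ g : ℂ → ℂ, AnalyticOnNhd ℂ g (Metric.ball 0 r) ∧ ∀ x, f x = g x}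
  mul_mem' := by
    rintro _ _ ⟨g, hg, h⟩ ⟨g', hg', h'⟩
    exact ⟨g * g', hg.mul hg', fun x => by simp [h, h']⟩
  one_mem' := ⟨1, analyticOnNhd_const, fun x => rfl⟩
  add_mem' := by
    rintro _ _ ⟨g, hg, h⟩ ⟨g', hg', h'⟩
    exact ⟨g + g', hg.add hg', fun x => by simp [h, h']⟩
  zero_mem' := ⟨0, analyticOnNhd_const, fun x => rfl⟩
  neg_mem' := by
    rintro _ ⟨g, hg, h⟩
    exact ⟨-g, hg.neg, fun x => by simp [h]⟩

/-- More analytic functions than the dimension of their target are linearly dependent over the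
analytic functions. -/
theorem exists_analytic_relation {r : ℝ} (hr : 0 < r) {n : ℕ} (w : Fin (n + 1) → Fin n → ℂ → ℂ)
    (hw : ∀ i j, AnalyticOnNhd ℂ (w i j) (Metric.ball 0 r)) :
    ∃ c : Fin (n + 1) → ℂ → ℂ, (∀ i, AnalyticOnNhd ℂ (c i) (Metric.ball 0 r)) ∧
      (∃ i, ∃ z ∈ Metric.ball (0 : ℂ) r, c i z ≠ 0) ∧
      ∀ z ∈ Metric.ball (0 : ℂ) r, ∀ j, ∑ i, c i z * w i j z = 0 := by
  -- A nonempty disc makes the ring nontrivial, so the strong rank condition forbids an injective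
  -- map from `n + 1` to `n` coordinates.
  have : Nonempty (Metric.ball (0 : ℂ) r) := ⟨⟨0, Metric.mem_ball_self hr⟩⟩
  let W : Matrix (Fin (n + 1)) (Fin n) (analyticRing r) :=
    fun i j => ⟨fun z => w i j z, w i j, hw i j, fun _ => rfl⟩
  have hinj : ¬ Function.Injective W.vecMulLinear := fun h =>
    absurd (le_of_fin_injective (analyticRing r) W.vecMulLinear h) (by omega)
  rw [← LinearMap.ker_eq_bot, Submodule.eq_bot_iff] at hinj
  push Not at hinj
  obtain ⟨c, hc, hc0⟩ := hinj
  obtain ⟨i, hi⟩ := Function.ne_iff.1 hc0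
  choose g hg hgc using fun i => (c i).2
  refine ⟨g, hg, ⟨i, ?_⟩, fun z hz j => ?_⟩
  · by_contra! h
    apply hi
    ext z
    rw [hgc, h z z.2]
    rfl
  · have h1 := congrArg (fun f : analyticRing r => f.1 ⟨z, hz⟩) (congrFun hc j)
    simp only [Matrix.vecMulLinear_apply, Matrix.vecMul, dotProduct] at h1
    simpa [W, hgc] using h1

/-- An operator with SVEP at `z` for which `ran (T - z)` has finite codimension has
`α(T - z) ≤ β(T - z)`. -/
theorem HasSVEPAt.finrank_ker_le [CompleteSpace Y] {T : Y →L[ℂ] Y} {z₀ : ℂ}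
    (h : HasSVEPAt T z₀) [hfin : FiniteDimensional ℂ (Y ⧸ (shift T z₀).range)] :
    FiniteDimensional ℂ (shift T z₀).ker ∧
      Module.finrank ℂ (shift T z₀).ker ≤ Module.finrank ℂ (Y ⧸ (shift T z₀).range) := by
  set S := shift T z₀ with hS
  set n := Module.finrank ℂ (Y ⧸ S.range) with hn
  -- Refuting `n + 1` independent kernel vectors also excludes an infinite-dimensional kernel.
  suffices hrank : ¬ ((n + 1 : ℕ) : Cardinal) ≤ Module.rank ℂ S.ker by
    rw [not_le] at hrank
    have hf : FiniteDimensional ℂ S.ker :=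
      Module.rank_lt_aleph0_iff.1 (hrank.trans (Cardinal.natCast_lt_aleph0))
    refine ⟨hf, ?_⟩
    rw [← Module.finrank_eq_rank, Nat.cast_lt] at hrank
    omega
  intro hrank
  obtain ⟨v, hv⟩ := Module.le_rank_iff.1 hrank
  obtain ⟨W, hW⟩ := Submodule.exists_isCompl S.range
  have eW := Submodule.quotientEquivOfIsCompl _ _ hW
  have : FiniteDimensional ℂ W := eW.finiteDimensional
  let b : Module.Basis (Fin n) ℂ W := Module.finBasisOfFinrankEq ℂ W eW.finrank_eq.symm
  have : CompleteSpace W := FiniteDimensional.complete ℂ W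
  -- A complement of the range makes `S` surjective. The kernel families then satisfy `S y(z) + w(z)
  -- = z y(z)` with `w(z) ∈ W` and `w(0) = 0`.
  let G : (Y × W) →L[ℂ] Y := S.coprod W.subtypeL
  let J : (Y × W) →L[ℂ] Y := ContinuousLinearMap.fst ℂ Y W
  have hG : Function.Surjective G := fun y => by
    obtain ⟨_, ⟨x, rfl⟩, w, hw, rfl⟩ := Submodule.mem_sup.1
      (hW.sup_eq_top ▸ Submodule.mem_top : y ∈ S.range ⊔ W)
    exact ⟨(x, ⟨w, hw⟩), by simp [G]⟩
  obtain ⟨r, hr, hker⟩ := exists_analytic_kernel G J hG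
  choose e he he0 heG using fun i => hker ((v i : Y), 0) (by simp [G])
  have hli : LinearIndependent ℂ fun i => (e i 0).1 := by
    simp only [he0]
    exact hv.map' S.ker.subtype (Submodule.ker_subtype _)
  have hcont : ContinuousAt (fun z i => (e i z).1) (0 : ℂ) :=
    continuousAt_pi.2 fun i =>
      continuous_fst.continuousAt.comp (he i 0 (Metric.mem_ball_self hr)).continuousAt
  obtain ⟨ρ, hρ, hρli⟩ := Metric.eventually_nhds_iff_ball.1 (hcont.eventually hli.eventually)
  set s := min r ρ with hs
  have hs0 : 0 < s := lt_min hr hρ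
  have hsr : Metric.ball (0 : ℂ) s ⊆ Metric.ball 0 r := Metric.ball_subset_ball (min_le_left _ _)
  have hsρ : Metric.ball (0 : ℂ) s ⊆ Metric.ball 0 ρ := Metric.ball_subset_ball (min_le_right _ _)
  let φ : Fin n → (Y × W) →L[ℂ] ℂ := fun j =>
    (LinearMap.toContinuousLinearMap (b.coord j)).comp (ContinuousLinearMap.snd ℂ Y W)
  obtain ⟨c, hc, ⟨i₀, z₁, hz₁, hne⟩, hrel⟩ := exists_analytic_relation hs0
    -- The relation cancels the `n` coordinates of the `W`-components, so the same combination of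
    -- the `Y`-components is killed by `S - z`. SVEP makes it vanish, against their independence at
    -- `z₁`.
    (fun i j z => φ j (e i z))
    (fun i j z hz => (φ j).analyticAt _ |>.fun_comp (he i z (hsr hz)))
  have hrelW : ∀ z ∈ Metric.ball (0 : ℂ) s, ∑ i, c i z • (e i z).2 = 0 := fun z hz => by
    refine b.ext_elem fun j => ?_
    simpa [φ] using hrel z hz j
  have hfz := h.eq_zero hs0 (f := fun z => ∑ i, c i z • (e i z).1)
    (fun z hz => Finset.analyticAt_fun_sum _ fun i _ => (hc i z hz).smul
      ((ContinuousLinearMap.fst ℂ Y W).analyticAt _ |>.fun_comp (he i z (hsr hz))))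
    (fun z hz => by
      rw [← hS, map_sum, Finset.smul_sum, ← sub_eq_zero, ← Finset.sum_sub_distrib]
      have h1 : ∀ i, S (c i z • (e i z).1) - z • c i z • (e i z).1 =
          -(c i z • ((e i z).2 : Y)) := fun i => by
        have h2 : S (e i z).1 + ((e i z).2 : Y) = z • (e i z).1 := by
          simpa [G, J] using heG i z (hsr hz)
        rw [map_smul, smul_comm z, ← h2, smul_add]
        abel
      simp only [h1, Finset.sum_neg_distrib, neg_eq_zero]
      simpa using congrArg (Subtype.val) (hrelW z hz))
  exact hne (Fintype.linearIndependent_iff.1 (hρli z₁ (hsρ hz₁)) _ (hfz z₁ hz₁) i₀)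

end SVEP

/-! ### Closed ranges. -/

section ClosedRange

variable {Y Z : Type*} [NormedAddCommGroup Y] [NormedSpace ℂ Y] [CompleteSpace Y]
  [NormedAddCommGroup Z] [NormedSpace ℂ Z] [CompleteSpace Z]

/-- An operator with closed range and finite-dimensional kernel maps closed subspaces to closed
subspaces. -/
theorem isClosed_map_of_isClosed_range {S : Y →L[ℂ] Z} (hS : IsClosed (S.range : Set Z))
    [FiniteDimensional ℂ S.ker] {L : Submodule ℂ Y} (hL : IsClosed (L : Set Y)) :
    IsClosed (L.map (S : Y →ₗ[ℂ] Z) : Set Z) := by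
  have : CompleteSpace S.range := hS.completeSpace_coe
  let S₁ : Y →L[ℂ] S.range := S.rangeRestrict
  have hS₁ : Function.Surjective S₁ := by
    rintro ⟨_, x, rfl⟩
    exact ⟨x, rfl⟩
  have hq := S₁.isQuotientMap hS₁
  have hcl : IsClosed ((L ⊔ S.ker : Submodule ℂ Y) : Set Y) :=
    Submodule.isClosed_sup_finiteDimensional _ _ hL
  -- Closedness is tested along the quotient map `S₁`, where the preimage of `S(L)` is `L + ker S`.
  have hpre : IsClosed {y : S.range | (y : Z) ∈ L.map (S : Y →ₗ[ℂ] Z)} := by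
    rw [← hq.isClosed_preimage]
    convert! hcl using 1
    rw [← Submodule.comap_map_eq]
    rfl
  convert! hS.isClosedEmbedding_subtypeVal.isClosedMap _ hpre using 1
  ext z
  constructor
  · rintro ⟨x, hx, rfl⟩
    exact ⟨⟨S x, x, rfl⟩, ⟨x, hx, rfl⟩, rfl⟩
  · rintro ⟨z, hz, rfl⟩
    exact hz

/-- The range of an operator between Banach spaces is closed if it has finite codimension. -/
theorem isClosed_range_of_finiteDimensional_coker (S : Y →L[ℂ] Z)
    [FiniteDimensional ℂ (Z ⧸ S.range)] : IsClosed (S.range : Set Z) := by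
  obtain ⟨W, hW⟩ := Submodule.exists_isCompl S.range
  have : FiniteDimensional ℂ W := (Submodule.quotientEquivOfIsCompl _ _ hW).finiteDimensional
  have : CompleteSpace W := FiniteDimensional.complete ℂ W
  let G : (Y × W) →L[ℂ] Z := S.coprod W.subtypeL
  have hG : Function.Surjective G := fun y => by
    obtain ⟨_, ⟨x, rfl⟩, w, hw, rfl⟩ := Submodule.mem_sup.1
      (hW.sup_eq_top ▸ Submodule.mem_top : y ∈ S.range ⊔ W)
    exact ⟨(x, ⟨w, hw⟩), by simp [G]⟩
  rw [← (G.isQuotientMap hG).isClosed_preimage]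
  -- As `W` meets the range trivially, `S y + w` lies in the range only for `w = 0`.
  have : G ⁻¹' (S.range : Set Z) = {p | p.2 = 0} := by
    ext ⟨y, w⟩
    have h1 : G (y, w) = S y + w := by simp [G]
    have h2 : S y ∈ S.range := ⟨y, rfl⟩
    simp only [mem_preimage, SetLike.mem_coe, mem_ofPred_eq, h1]
    rw [Submodule.add_mem_iff_right _ h2]
    constructor
    · intro h
      exact Subtype.ext (Submodule.disjoint_def.1 hW.disjoint _ h w.2)
    · rintro rfl
      exact zero_mem _
  rw [this]
  exact isClosed_eq continuous_snd continuous_const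

end ClosedRange

/-! ### Duality between kernels and cokernels. -/

section Dual

variable {Y : Type*} [NormedAddCommGroup Y] [NormedSpace ℂ Y]

@[simp] theorem dualOp_apply (T : Y →L[ℂ] Y) (φ : StrongDual ℂ Y) (y : Y) :
    dualOp T φ y = φ (T y) := rfl

theorem shift_apply (T : Y →L[ℂ] Y) (z : ℂ) (y : Y) : shift T z y = T y - z • y := rfl

theorem shift_dualOp (T : Y →L[ℂ] Y) (z : ℂ) : shift (dualOp T) z = dualOp (shift T z) := by
  ext φ y
  simp [shift_apply]

theorem isUnit_dualOp {T : Y →L[ℂ] Y} (h : IsUnit T) : IsUnit (dualOp T) := by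
  obtain ⟨⟨S, R, hSR, hRS⟩, rfl⟩ := h
  refine ⟨⟨dualOp S, dualOp R, ?_, ?_⟩, rfl⟩
  · ext φ y
    exact congrArg φ (congrArg (fun U : Y →L[ℂ] Y => U y) hRS)
  · ext φ y
    exact congrArg φ (congrArg (fun U : Y →L[ℂ] Y => U y) hSR)

theorem notMem_spectrum_iff_isUnit {T : Y →L[ℂ] Y} {z : ℂ} :
    z ∉ spectrum ℂ T ↔ IsUnit (shift T z) := by
  rw [spectrum.notMem_iff, ← IsUnit.neg_iff, neg_sub]
  rfl

theorem notMem_spectrum_iff [CompleteSpace Y] {T : Y →L[ℂ] Y} {z : ℂ} :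
    z ∉ spectrum ℂ T ↔ Function.Bijective (shift T z) :=
  notMem_spectrum_iff_isUnit.trans ContinuousLinearMap.isUnit_iff_bijective

theorem notMem_spectrum_dualOp {T : Y →L[ℂ] Y} {z : ℂ} (h : z ∉ spectrum ℂ T) :
    z ∉ spectrum ℂ (dualOp T) := by
  rw [notMem_spectrum_iff_isUnit, shift_dualOp]
  exact isUnit_dualOp (notMem_spectrum_iff_isUnit.1 h)

theorem exists_dual_ne_zero_of_notMem {R : Submodule ℂ Y} (hR : IsClosed (R : Set Y)) {x : Y}
    (hx : x ∉ R) : ∃ φ : StrongDual ℂ Y, (∀ y ∈ R, φ y = 0) ∧ φ x ≠ 0 := by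
  have : IsClosed (R : Set Y) := hR
  have hq : (R.mkQ x) ≠ 0 := by simpa using hx
  obtain ⟨g, hg⟩ := SeparatingDual.exists_ne_zero (R := ℂ) hq
  exact ⟨g.comp R.mkQL, fun y hy => by simp [(Submodule.Quotient.mk_eq_zero R).2 hy], hg⟩

/-- The pairing embeds `Y ⧸ R` into the algebraic dual of `K`. -/
theorem finrank_quotient_le_of_mem_iff {E : Type*} [NormedAddCommGroup E] [NormedSpace ℂ E]
    (p : E →ₗ[ℂ] Y →ₗ[ℂ] ℂ) {R : Submodule ℂ Y} {K : Submodule ℂ E}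
    [FiniteDimensional ℂ K] (h : ∀ x, x ∈ R ↔ ∀ φ ∈ K, p φ x = 0) :
    FiniteDimensional ℂ (Y ⧸ R) ∧ Module.finrank ℂ (Y ⧸ R) ≤ Module.finrank ℂ K := by
  let τ : Y →ₗ[ℂ] Module.Dual ℂ K := (p ∘ₗ K.subtype).flip
  have hτ : R = τ.ker := by
    ext x
    rw [h, LinearMap.mem_ker]
    exact ⟨fun hx => LinearMap.ext fun φ => hx φ φ.2, fun hx φ hφ => LinearMap.congr_fun hx ⟨φ, hφ⟩⟩
  let e : (Y ⧸ R) ≃ₗ[ℂ] τ.range := (Submodule.quotEquivOfEq _ _ hτ).trans τ.quotKerEquivRange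
  refine ⟨e.symm.finiteDimensional, ?_⟩
  calc _ = Module.finrank ℂ τ.range := e.finrank_eq
    _ ≤ Module.finrank ℂ (Module.Dual ℂ K) := Submodule.finrank_le _
    _ = Module.finrank ℂ K := Subspace.dual_finrank_eq

theorem mem_range_iff_forall_ker_dualOp {S : Y →L[ℂ] Y} (hcl : IsClosed (S.range : Set Y)) (x : Y) :
    x ∈ S.range ↔ ∀ φ ∈ (dualOp S).ker, φ x = 0 := by
  constructor
  · rintro ⟨y, rfl⟩ φ hφ
    exact DFunLike.congr_fun (LinearMap.mem_ker.1 hφ) y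
  · intro hx
    by_contra hxR
    obtain ⟨φ, hφ, hφx⟩ := exists_dual_ne_zero_of_notMem hcl hxR
    refine hφx (hx φ ?_)
    ext y
    exact hφ _ ⟨y, rfl⟩

variable [CompleteSpace Y]

/-- A functional that vanishes on the kernel of an operator with closed range lies in the range of
the adjoint. -/
theorem exists_dualOp_eq {S : Y →L[ℂ] Y} (hS : IsClosed (S.range : Set Y)) {φ : StrongDual ℂ Y}
    (hφ : ∀ y, S y = 0 → φ y = 0) : ∃ ψ, dualOp S ψ = φ := by
  have : CompleteSpace S.range := hS.completeSpace_coe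
  let S₁ : Y →L[ℂ] S.range := S.rangeRestrict
  have hS₁ : Function.Surjective S₁ := by
    rintro ⟨_, x, rfl⟩
    exact ⟨x, rfl⟩
  obtain ⟨c, hc, hpre⟩ := S₁.exists_preimage_norm_le hS₁
  choose g hg hgn using hpre
  -- The section `g` need not be linear, but `φ ∘ g` is, because `φ` vanishes on `ker S`.
  have hφ' : ∀ y y', S₁ y = S₁ y' → φ y = φ y' := fun y y' h => by
    rw [← sub_eq_zero, ← map_sub]
    refine hφ _ ?_
    rw [map_sub, sub_eq_zero]
    exact congrArg Subtype.val h
  let ψ₀ : S.range →ₗ[ℂ] ℂ :=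
    { toFun := fun y => φ (g y)
      map_add' := fun y y' => by
        rw [← map_add]
        exact hφ' _ _ (by rw [map_add, hg, hg, hg])
      map_smul' := fun a y => by
        rw [RingHom.id_apply, ← map_smul]
        exact hφ' _ _ (by rw [map_smul, hg, hg]) }
  let ψ₁ : StrongDual ℂ S.range := ψ₀.mkContinuous (‖φ‖ * c) fun y => by
    calc ‖φ (g y)‖ ≤ ‖φ‖ * ‖g y‖ := φ.le_opNorm _
      _ ≤ ‖φ‖ * (c * ‖y‖) := by gcongr; exact hgn y
      _ = ‖φ‖ * c * ‖y‖ := by ring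
  obtain ⟨ψ, hψ, -⟩ := exists_extension_norm_eq S.range ψ₁
  refine ⟨ψ, ?_⟩
  ext y
  rw [dualOp_apply]
  exact (hψ (S₁ y)).trans (hφ' _ _ (hg _))

/-- Functionals vanishing on `ker S` lie in `ran S*`, so restriction to `ker S` controls `coker S*`.
-/
theorem finrank_coker_dualOp_le {S : Y →L[ℂ] Y} (hcl : IsClosed (S.range : Set Y))
    [FiniteDimensional ℂ S.ker] :
    FiniteDimensional ℂ (StrongDual ℂ Y ⧸ (dualOp S).range) ∧
      Module.finrank ℂ (StrongDual ℂ Y ⧸ (dualOp S).range) ≤ Module.finrank ℂ S.ker := by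
  let ρ : StrongDual ℂ Y →ₗ[ℂ] Module.Dual ℂ S.ker :=
    (LinearMap.lcomp ℂ ℂ S.ker.subtype) ∘ₗ ContinuousLinearMap.coeLM ℂ
  have hρ : ρ.ker ≤ (dualOp S).range := fun φ hφ =>
    exists_dualOp_eq hcl fun y hy => LinearMap.congr_fun (LinearMap.mem_ker.1 hφ) ⟨y, hy⟩
  have : FiniteDimensional ℂ (StrongDual ℂ Y ⧸ ρ.ker) :=
    ρ.quotKerEquivRange.symm.finiteDimensional
  have hsurj := Submodule.factor_surjective hρ
  refine ⟨Module.Finite.of_surjective _ hsurj, ?_⟩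
  calc _ ≤ Module.finrank ℂ (StrongDual ℂ Y ⧸ ρ.ker) :=
        LinearMap.finrank_le_finrank_of_surjective hsurj
    _ = Module.finrank ℂ ρ.range := ρ.quotKerEquivRange.finrank_eq
    _ ≤ Module.finrank ℂ (Module.Dual ℂ S.ker) := Submodule.finrank_le _
    _ = Module.finrank ℂ S.ker := Subspace.dual_finrank_eq

/-- If the adjoint of `T` has SVEP at `z` and `T - z` is upper semi-Fredholm, then
`β(T - z) ≤ α(T - z)`. -/
theorem HasSVEPAt.finrank_coker_le {T : Y →L[ℂ] Y} {z : ℂ} (h : HasSVEPAt (dualOp T) z)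
    (hcl : IsClosed ((shift T z).range : Set Y)) [FiniteDimensional ℂ (shift T z).ker] :
    FiniteDimensional ℂ (Y ⧸ (shift T z).range) ∧
      Module.finrank ℂ (Y ⧸ (shift T z).range) ≤ Module.finrank ℂ (shift T z).ker := by
  have key := @HasSVEPAt.finrank_ker_le _ _ _ _ _ _ h
  rw [shift_dualOp] at key
  obtain ⟨h₁, h₁'⟩ := finrank_coker_dualOp_le hcl
  obtain ⟨h₂, h₂'⟩ := key (hfin := h₁)
  obtain ⟨h₃, h₃'⟩ := finrank_quotient_le_of_mem_iff (E := StrongDual ℂ Y)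
    (K := (dualOp (shift T z)).ker) (ContinuousLinearMap.coeLM ℂ)
    (mem_range_iff_forall_ker_dualOp hcl)
  -- With `S = T - z`, the chain is `β(S) ≤ α(S*) ≤ β(S*) ≤ α(S)`; SVEP is the middle step.
  exact ⟨h₃, h₃'.trans (h₂'.trans h₁')⟩

end Dual

/-! ### Fredholm points that are not accumulation points of the spectrum. -/

section Isolated

variable {Y : Type*} [NormedAddCommGroup Y] [NormedSpace ℂ Y]

/-- Invertibility kills `f` near but off `z₀`; the identity theorem extends this to the disc. -/
theorem hasSVEPAt_of_eventually_notMem_spectrum {T : Y →L[ℂ] Y} {z₀ : ℂ}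
    (h : ∀ᶠ z in 𝓝[≠] z₀, z ∉ spectrum ℂ T) : HasSVEPAt T z₀ := by
  intro r hr f hf hT
  have hball : ∀ᶠ z in 𝓝[≠] z₀, z ∈ Metric.ball z₀ r :=
    eventually_nhdsWithin_of_eventually_nhds (Metric.ball_mem_nhds z₀ hr)
  have h0 : ∀ᶠ z in 𝓝[≠] z₀, f z = 0 := by
    filter_upwards [h, hball] with z hz hzb
    obtain ⟨u, hu⟩ := notMem_spectrum_iff_isUnit.1 hz
    have h1 := hT z hzb
    rw [← hu] at h1
    have h2 : (u⁻¹.1 * u.1) (f z) = u⁻¹.1 0 := congrArg u⁻¹.1 h1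
    rwa [Units.inv_mul, map_zero] at h2
  exact hf.eqOn_zero_of_preconnected_of_frequently_eq_zero
    (convex_ball z₀ r).isPreconnected (Metric.mem_ball_self hr) h0.frequently

/-- This is how the polaroid hypothesis enters: through finite descent. -/
theorem PolaroidAt.finiteDimensional_coker {T : Y →L[ℂ] Y} {z : ℂ} (h : PolaroidAt T z)
    [FiniteDimensional ℂ (shift T z).ker] : FiniteDimensional ℂ (Y ⧸ (shift T z).range) := by
  have h1 : descent (shift T z) < ⊤ := h.1 ▸ h.2
  obtain ⟨_, ⟨n, hn, rfl⟩, -⟩ := sInf_lt_iff.1 h1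
  simp only [mem_ofPred_eq, ContinuousLinearMap.toLinearMap_pow] at hn
  exact finiteDimensional_coker_of_range_pow_eq _ hn

variable [CompleteSpace Y]

/-- SVEP at `z` forces a Fredholm operator `T - z` to have finite ascent. -/
theorem HasSVEPAt.exists_ker_pow_eq {T : Y →L[ℂ] Y} {z₀ : ℂ} (h : HasSVEPAt T z₀)
    [FiniteDimensional ℂ (shift T z₀).ker] [FiniteDimensional ℂ (Y ⧸ (shift T z₀).range)] :
    ∃ n : ℕ, (shift T z₀ ^ n).ker = (shift T z₀ ^ (n + 1)).ker := by
  set S := shift T z₀ with hS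
  have hcl : ∀ n : ℕ, IsClosed ((S ^ n).range : Set Y) := fun n => by
    have : FiniteDimensional ℂ (Y ⧸ (S ^ n).range) := by
      rw [ContinuousLinearMap.toLinearMap_pow]
      exact (finiteDimensional_ker_coker_pow (S : Y →ₗ[ℂ] Y) n).2.1
    exact isClosed_range_of_finiteDimensional_coker _
  have hanti : Antitone fun n : ℕ => (S ^ n).range := antitone_nat_of_succ_le fun n => by
    rintro _ ⟨y, rfl⟩
    exact ⟨S y, by rw [pow_succ]; rfl⟩
  -- The subspaces `ker S ∩ ran Sⁿ` decrease inside a finite-dimensional space, hence stabilise.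
  let N : ℕ →o (Submodule ℂ S.ker)ᵒᵈ :=
    ⟨fun n => OrderDual.toDual ((S ^ n).range.comap S.ker.subtype),
      fun m n hmn => Submodule.comap_mono (hanti hmn)⟩
  obtain ⟨n, hn⟩ := IsArtinian.monotone_stabilizes N
  have hstab : ∀ m, n ≤ m → ∀ x, S x = 0 → x ∈ (S ^ n).range → x ∈ (S ^ m).range :=
    fun m hm x hx hxn => by
      have h1 : (S ^ n).range.comap S.ker.subtype = (S ^ m).range.comap S.ker.subtype := hn m hm
      have h2 : (⟨x, hx⟩ : S.ker) ∈ (S ^ n).range.comap S.ker.subtype := hxn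
      rw [h1] at h2
      exact h2
  let R : Submodule ℂ Y := ⨅ m, (S ^ m).range
  have hRmem : ∀ x, x ∈ R ↔ ∀ m, x ∈ (S ^ m).range := fun x => Submodule.mem_iInf _
  have hRn : ∀ x, (∀ m, n ≤ m → x ∈ (S ^ m).range) → x ∈ R := fun x hx =>
    (hRmem x).2 fun m => hanti (le_max_left m n) (hx _ (le_max_right m n))
  have hRS : ∀ x ∈ R, S x ∈ R := fun x hx => (hRmem _).2 fun m => by
    obtain ⟨y, rfl⟩ := (hRmem x).1 hx m
    refine ⟨S y, ?_⟩
    change (S ^ m * S) y = (S * S ^ m) y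
    rw [← pow_succ, ← pow_succ']
  have hRcl : IsClosed (R : Set Y) := by
    rw [Submodule.coe_iInf]
    exact isClosed_iInter hcl
  have : CompleteSpace R := hRcl.completeSpace_coe
  let G : R →L[ℂ] R := (S.comp R.subtypeL).codRestrict R fun x => hRS x x.2
  -- Two preimages of `x`, taken in `ran Sⁿ` and `ran Sᵐ`, differ by a kernel vector in `ran Sⁿ`,
  -- which stabilisation places in `ran Sᵐ`.
  have hG : Function.Surjective G := by
    rintro ⟨x, hx⟩
    have hpre : ∀ m, ∃ y ∈ (S ^ m).range, S y = x := fun m => by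
      obtain ⟨y, hy⟩ := (hRmem x).1 hx (m + 1)
      exact ⟨(S ^ m) y, ⟨y, rfl⟩, by rw [← hy, pow_succ']; rfl⟩
    obtain ⟨y, hy, hyx⟩ := hpre n
    refine ⟨⟨y, hRn y fun m hm => ?_⟩, Subtype.ext hyx⟩
    obtain ⟨y', hy', hyx'⟩ := hpre m
    have h1 : y - y' ∈ (S ^ m).range :=
      hstab m hm _ (by rw [map_sub, hyx, hyx', sub_self]) (sub_mem hy (hanti hm hy'))
    simpa using add_mem h1 hy'
  obtain ⟨r, hr, hfam⟩ := exists_analytic_kernel G (ContinuousLinearMap.id ℂ R) hG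
  -- Since `S` maps `R` onto itself, a kernel vector in `R` extends to an analytic family, which
  -- SVEP annihilates.
  have hbot : ∀ x, S x = 0 → x ∈ R → x = 0 := fun x hx hxR => by
    obtain ⟨e, he, he0, heG⟩ := hfam ⟨x, hxR⟩ (Subtype.ext hx)
    have h0 := h.eq_zero hr (f := fun z => (e z : Y))
      (fun z hz => (R.subtypeL.analyticAt _).fun_comp (he z hz))
      (fun z hz => congrArg Subtype.val (heG z hz)) 0 (Metric.mem_ball_self hr)
    simpa [he0] using h0
  refine ⟨n, le_antisymm (fun x hx => ?_) fun x hx => ?_⟩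
  · have hx' : (S ^ n) x = 0 := hx
    change (S ^ (n + 1)) x = 0
    rw [pow_succ']
    change S ((S ^ n) x) = 0
    rw [hx', map_zero]
  -- Here `Sⁿ x ∈ ker S ∩ ran Sⁿ`, which is contained in `R`.
  · have hx' : (S * S ^ n) x = 0 := by rw [← pow_succ']; exact hx
    exact hbot _ hx' (hRn _ fun m hm => hstab m hm _ hx' ⟨x, rfl⟩)

/-- A Fredholm operator `T - z`, where `z` is not an accumulation point of the spectrum of `T`, has
index zero and finite equal ascent and descent. -/
theorem index_eq_zero_and_polaroidAt {T : Y →L[ℂ] Y} {z : ℂ}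
    (h : ∀ᶠ w in 𝓝[≠] z, w ∉ spectrum ℂ T)
    [FiniteDimensional ℂ (shift T z).ker] [FiniteDimensional ℂ (Y ⧸ (shift T z).range)] :
    index (shift T z) = 0 ∧ PolaroidAt T z := by
  have hsvep := hasSVEPAt_of_eventually_notMem_spectrum h
  have hsvep' := hasSVEPAt_of_eventually_notMem_spectrum (h.mono fun w => notMem_spectrum_dualOp)
  have h1 := hsvep.finrank_ker_le.2
  have h2 := (hsvep'.finrank_coker_le (isClosed_range_of_finiteDimensional_coker _)).2
  have h3 : index (shift T z) = 0 := by rw [index]; omega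
  obtain ⟨n, hn⟩ := hsvep.exists_ker_pow_eq
  have hset : {n : ℕ | (shift T z ^ n).ker = (shift T z ^ (n + 1)).ker} =
      {n : ℕ | (shift T z ^ n).range = (shift T z ^ (n + 1)).range} := by
    ext m
    simp only [mem_ofPred_eq, ContinuousLinearMap.toLinearMap_pow]
    exact ker_pow_eq_iff_range_pow_eq _ h3 m
  refine ⟨h3, by rw [ascent, descent, hset], ?_⟩
  exact (sInf_le ⟨n, hn, rfl⟩ : ascent (shift T z) ≤ n).trans_lt (ENat.natCast_lt_top n)

theorem polaroidAt_of_notMem_spectrum {T : Y →L[ℂ] Y} {z : ℂ} (h : z ∉ spectrum ℂ T) :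
    PolaroidAt T z := by
  have hb := notMem_spectrum_iff.1 h
  have hk : (shift T z).ker = ⊥ := LinearMap.ker_eq_bot.2 hb.1
  have hr : (shift T z).range = ⊤ := LinearMap.range_eq_top.2 hb.2
  have : FiniteDimensional ℂ (shift T z).ker := by rw [hk]; infer_instance
  have : FiniteDimensional ℂ (Y ⧸ (shift T z).range) := by rw [hr]; infer_instance
  exact (index_eq_zero_and_polaroidAt (eventually_nhdsWithin_of_eventually_nhds
    ((spectrum.isClosed T).isOpen_compl.mem_nhds h))).2

end Isolated

/-! ### Weyl operators and isolated points. -/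

section Spectra

variable {Y : Type*} [NormedAddCommGroup Y] [NormedSpace ℂ Y]

theorem isWeyl_iff [CompleteSpace Y] {S : Y →L[ℂ] Y} :
    IsWeyl S ↔ FiniteDimensional ℂ S.ker ∧ FiniteDimensional ℂ (Y ⧸ S.range) ∧ index S = 0 := by
  constructor
  · rintro ⟨⟨-, h₁⟩, ⟨-, h₂⟩, h₃⟩
    exact ⟨h₁, h₂, h₃⟩
  · rintro ⟨h₁, h₂, h₃⟩
    have hcl := isClosed_range_of_finiteDimensional_coker S
    exact ⟨⟨hcl, h₁⟩, ⟨hcl, h₂⟩, h₃⟩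

theorem notMem_weylSpectrum {T : Y →L[ℂ] Y} {z : ℂ} :
    z ∉ weylSpectrum T ↔ IsWeyl (shift T z) := not_not

theorem isWeyl_of_bijective [CompleteSpace Y] {S : Y →L[ℂ] Y} (h : Function.Bijective S) :
    IsWeyl S := by
  have hk : S.ker = ⊥ := LinearMap.ker_eq_bot.2 h.1
  have hr : S.range = ⊤ := LinearMap.range_eq_top.2 h.2
  rw [isWeyl_iff, index, hk, hr]
  refine ⟨inferInstance, inferInstance, ?_⟩
  rw [finrank_bot, Module.finrank_zero_of_subsingleton, sub_self]

theorem IsWeyl.bijective_of_injective {S : Y →L[ℂ] Y} (hS : IsWeyl S)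
    (h : Function.Injective S) : Function.Bijective S := by
  obtain ⟨-, ⟨-, hfin⟩, hind⟩ := hS
  have hk : S.ker = ⊥ := LinearMap.ker_eq_bot.2 h
  rw [index, hk, finrank_bot, Nat.cast_zero, zero_sub, neg_eq_zero, Nat.cast_eq_zero,
    Module.finrank_zero_iff, Submodule.Quotient.subsingleton_iff] at hind
  exact ⟨h, LinearMap.range_eq_top.1 hind⟩

theorem IsWeyl.bijective_of_surjective {S : Y →L[ℂ] Y} (hS : IsWeyl S)
    (h : Function.Surjective S) : Function.Bijective S := by
  obtain ⟨⟨-, hfin⟩, -, hind⟩ := hS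
  have hr : S.range = ⊤ := LinearMap.range_eq_top.2 h
  rw [index, hr, Module.finrank_zero_of_subsingleton (M := Y ⧸ (⊤ : Submodule ℂ Y)),
    Nat.cast_zero, sub_zero, Nat.cast_eq_zero, Submodule.finrank_eq_zero] at hind
  exact ⟨LinearMap.ker_eq_bot.1 hind, h⟩

theorem mem_isoSpectrum_iff {T : Y →L[ℂ] Y} {z : ℂ} :
    z ∈ isoSpectrum T ↔ z ∈ spectrum ℂ T ∧ ∀ᶠ w in 𝓝[≠] z, w ∉ spectrum ℂ T := by
  rw [eventually_nhdsWithin_iff]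
  refine and_congr_right fun hz => ⟨?_, fun h => ?_⟩
  · rintro ⟨U, hU, hUz⟩
    filter_upwards [hU] with w hw hwz hwT
    exact hwz (hUz.subset ⟨hw, hwT⟩)
  · refine ⟨_, h, ?_⟩
    ext w
    constructor
    · rintro ⟨hw, hwT⟩
      by_contra hwz
      exact hw hwz hwT
    · rintro rfl
      exact ⟨fun hw => absurd rfl hw, hz⟩

end Spectra

/-! ### Fredholm properties of triangular matrices and their diagonal entries. -/

section Triangular

variable {X : Type*} [NormedAddCommGroup X] [NormedSpace ℂ X]

@[simp] theorem opMatrix_apply (A B C : X →L[ℂ] X) (x y : X) :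
    opMatrix A B C (x, y) = (A x + C y, B y) := rfl

theorem shift_opMatrix (A B C : X →L[ℂ] X) (z : ℂ) :
    shift (opMatrix A B C) z = opMatrix (shift A z) (shift B z) C := by
  refine ContinuousLinearMap.ext fun p => ?_
  obtain ⟨x, y⟩ := p
  simp only [shift_apply, opMatrix_apply, Prod.smul_mk, Prod.mk_sub_mk]
  congr 1
  abel

theorem exists_exact_opMatrix (A B C : X →L[ℂ] X) :
    ∃ (f₀ : A.ker →ₗ[ℂ] (opMatrix A B C).ker) (f₁ : (opMatrix A B C).ker →ₗ[ℂ] B.ker)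
      (f₂ : B.ker →ₗ[ℂ] X ⧸ A.range) (f₃ : (X ⧸ A.range) →ₗ[ℂ] (X × X) ⧸ (opMatrix A B C).range)
      (f₄ : ((X × X) ⧸ (opMatrix A B C).range) →ₗ[ℂ] X ⧸ B.range),
      Function.Injective f₀ ∧ Function.Exact f₀ f₁ ∧ Function.Exact f₁ f₂ ∧ Function.Exact f₂ f₃ ∧
        Function.Exact f₃ f₄ ∧ Function.Surjective f₄ :=
  exists_exact_triangular (A : X →ₗ[ℂ] X) (C : X →ₗ[ℂ] X) (B : X →ₗ[ℂ] X) _ fun _ _ => rfl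

variable {A B : X →L[ℂ] X} (C : X →L[ℂ] X)

theorem finiteDimensional_ker_left [FiniteDimensional ℂ (opMatrix A B C).ker] :
    FiniteDimensional ℂ A.ker := by
  obtain ⟨f₀, f₁, f₂, f₃, f₄, h₀, h₁, h₂, h₃, h₄, h₅⟩ := exists_exact_opMatrix A B C
  exact Module.Finite.of_injective f₀ h₀

theorem finiteDimensional_coker_right [FiniteDimensional ℂ ((X × X) ⧸ (opMatrix A B C).range)] :
    FiniteDimensional ℂ (X ⧸ B.range) := by
  obtain ⟨f₀, f₁, f₂, f₃, f₄, h₀, h₁, h₂, h₃, h₄, h₅⟩ := exists_exact_opMatrix A B C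
  exact Module.Finite.of_surjective f₄ h₅

theorem finiteDimensional_coker_left [FiniteDimensional ℂ ((X × X) ⧸ (opMatrix A B C).range)]
    [FiniteDimensional ℂ B.ker] : FiniteDimensional ℂ (X ⧸ A.range) := by
  obtain ⟨f₀, f₁, f₂, f₃, f₄, h₀, h₁, h₂, h₃, h₄, h₅⟩ := exists_exact_opMatrix A B C
  exact finiteDimensional_of_exact h₃

theorem finiteDimensional_ker_right [FiniteDimensional ℂ (opMatrix A B C).ker]
    [FiniteDimensional ℂ (X ⧸ A.range)] : FiniteDimensional ℂ B.ker := by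
  obtain ⟨f₀, f₁, f₂, f₃, f₄, h₀, h₁, h₂, h₃, h₄, h₅⟩ := exists_exact_opMatrix A B C
  exact finiteDimensional_of_exact h₂

theorem finiteDimensional_ker_opMatrix [FiniteDimensional ℂ A.ker] [FiniteDimensional ℂ B.ker] :
    FiniteDimensional ℂ (opMatrix A B C).ker := by
  obtain ⟨f₀, f₁, f₂, f₃, f₄, h₀, h₁, h₂, h₃, h₄, h₅⟩ := exists_exact_opMatrix A B C
  exact finiteDimensional_of_exact h₁

theorem finiteDimensional_coker_opMatrix [FiniteDimensional ℂ (X ⧸ A.range)]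
    [FiniteDimensional ℂ (X ⧸ B.range)] :
    FiniteDimensional ℂ ((X × X) ⧸ (opMatrix A B C).range) := by
  obtain ⟨f₀, f₁, f₂, f₃, f₄, h₀, h₁, h₂, h₃, h₄, h₅⟩ := exists_exact_opMatrix A B C
  exact finiteDimensional_of_exact h₄

theorem index_opMatrix [FiniteDimensional ℂ A.ker] [FiniteDimensional ℂ B.ker]
    [FiniteDimensional ℂ (X ⧸ A.range)] [FiniteDimensional ℂ (X ⧸ B.range)] :
    index (opMatrix A B C) = index A + index B := by
  have := finiteDimensional_ker_opMatrix (A := A) (B := B) C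
  have := finiteDimensional_coker_opMatrix (A := A) (B := B) C
  obtain ⟨f₀, f₁, f₂, f₃, f₄, h₀, h₁, h₂, h₃, h₄, h₅⟩ := exists_exact_opMatrix A B C
  have key := Module.sum_neg_one_pow_finrank_eq_zero_of_exact_six f₀ f₁ f₂ f₃ f₄ h₀ h₁ h₂ h₃ h₄ h₅
  simp only [index]
  linarith

theorem ker_opMatrix_ne_bot_of_ne_bot (h : (opMatrix A B C).ker ≠ ⊥) :
    (opMatrix A B 0).ker ≠ ⊥ := by
  contrapose! h
  rw [LinearMap.ker_eq_bot'] at h ⊢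
  rintro ⟨x, y⟩ hxy
  obtain ⟨h1, h2⟩ : A x + C y = 0 ∧ B y = 0 := Prod.mk.inj hxy
  have hy : y = 0 := (Prod.mk.inj (h (0, y) (by simp [h2]))).2
  subst hy
  rw [map_zero, add_zero] at h1
  exact h (x, 0) (by simp [h1])

theorem injective_left_of_injective (h : Function.Injective (opMatrix A B C)) :
    Function.Injective A := fun x x' hx => by
  have : opMatrix A B C (x, 0) = opMatrix A B C (x', 0) := by simp [hx]
  exact (Prod.mk.inj (h this)).1

theorem surjective_right_of_surjective (h : Function.Surjective (opMatrix A B C)) :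
    Function.Surjective B := fun y => by
  obtain ⟨⟨x, y'⟩, hx⟩ := h (0, y)
  exact ⟨y', (Prod.mk.inj hx).2⟩

theorem bijective_opMatrix (hA : Function.Bijective A) (hB : Function.Bijective B) :
    Function.Bijective (opMatrix A B C) := by
  constructor
  · rintro ⟨x, y⟩ ⟨x', y'⟩ h
    obtain ⟨h1, h2⟩ : A x + C y = A x' + C y' ∧ B y = B y' := Prod.mk.inj h
    have hy := hB.1 h2
    subst hy
    rw [hA.1 (add_right_cancel h1)]
  · rintro ⟨u, v⟩
    obtain ⟨y, rfl⟩ := hB.2 v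
    obtain ⟨x, hx⟩ := hA.2 (u - C y)
    exact ⟨(x, y), by simp [hx]⟩

theorem bijective_of_bijective_opMatrix_zero (h : Function.Bijective (opMatrix A B 0)) :
    Function.Bijective A ∧ Function.Bijective B := by
  refine ⟨⟨injective_left_of_injective 0 h.1, fun u => ?_⟩, fun y y' hy => ?_,
    surjective_right_of_surjective 0 h.2⟩
  · obtain ⟨⟨x, y⟩, hx⟩ := h.2 (u, 0)
    exact ⟨x, by simpa using (Prod.mk.inj hx).1⟩
  · have : opMatrix A B 0 (0, y) = opMatrix A B 0 (0, y') := by simp [hy]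
    exact (Prod.mk.inj (h.1 this)).2

theorem isUpperSemiFredholm_left [CompleteSpace X] (h : IsUpperSemiFredholm (opMatrix A B C)) :
    IsUpperSemiFredholm A := by
  obtain ⟨hcl, hk⟩ := h
  refine ⟨?_, finiteDimensional_ker_left (B := B) C⟩
  -- The range of `A` is the first-coordinate slice of the image of the closed subspace `X ⊕ 0`.
  have hL : IsClosed ((ContinuousLinearMap.snd ℂ X X).ker : Set (X × X)) :=
    (ContinuousLinearMap.snd ℂ X X).isClosed_ker
  have h1 := (isClosed_map_of_isClosed_range hcl hL).preimage
    (Continuous.prodMk_left (0 : X) : Continuous fun x : X => (x, (0 : X)))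
  convert! h1 using 1
  ext u
  constructor
  · rintro ⟨x, rfl⟩
    exact ⟨(x, 0), rfl, by simp⟩
  · rintro ⟨⟨x, y⟩, hy, hu⟩
    have hy : y = 0 := hy
    subst hy
    exact ⟨x, by simpa using (Prod.mk.inj hu).1⟩

/-- In the diagonal case `ker B` embeds in the kernel of the matrix, so both entries are Fredholm.
-/
theorem IsWeyl.finiteDimensional_of_opMatrix_zero (h : IsWeyl (opMatrix A B 0)) :
    (FiniteDimensional ℂ A.ker ∧ FiniteDimensional ℂ (X ⧸ A.range)) ∧
      FiniteDimensional ℂ B.ker ∧ FiniteDimensional ℂ (X ⧸ B.range) := by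
  obtain ⟨⟨-, h₁⟩, ⟨-, h₂⟩, -⟩ := h
  have hA := finiteDimensional_ker_left (A := A) (B := B) 0
  have hB := finiteDimensional_coker_right (A := A) (B := B) 0
  have hB' : FiniteDimensional ℂ B.ker := by
    refine Module.Finite.of_injective
      ((LinearMap.inr ℂ X X).restrict (p := B.ker) (q := (opMatrix A B 0).ker) fun y hy => ?_) ?_
    · have hy : B y = 0 := hy
      change opMatrix A B 0 (0, y) = 0
      rw [opMatrix_apply, hy, map_zero, zero_apply, add_zero, Prod.mk_zero_zero]
    · rintro ⟨y, hy⟩ ⟨y', hy'⟩ h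
      exact Subtype.ext (Prod.mk.inj (congrArg Subtype.val h)).2
  exact ⟨⟨hA, finiteDimensional_coker_left (B := B) 0⟩, hB', hB⟩

end Triangular

/-! ### Comparison of `M_C` with `M_0` and transfer of Weyl's theorem. -/

section Weyl

variable {X : Type*} [NormedAddCommGroup X] [NormedSpace ℂ X] [CompleteSpace X]
  {A B : X →L[ℂ] X} (C : X →L[ℂ] X)

theorem isWeyl_opMatrix_of_fredholm (D : X →L[ℂ] X)
    [FiniteDimensional ℂ A.ker] [FiniteDimensional ℂ B.ker]
    [FiniteDimensional ℂ (X ⧸ A.range)] [FiniteDimensional ℂ (X ⧸ B.range)]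
    (h : index (opMatrix A B C) = 0) : IsWeyl (opMatrix A B D) := by
  rw [isWeyl_iff]
  refine ⟨finiteDimensional_ker_opMatrix D, finiteDimensional_coker_opMatrix D, ?_⟩
  rwa [index_opMatrix, ← index_opMatrix C]

/-- Under any of the SVEP hypotheses, `M_C - z` is Weyl only if `M_0 - z` is. -/
theorem isWeyl_opMatrix_zero (hSVEP : SVEPHypI A B ∨ SVEPHypII A B ∨ SVEPHypIII A B) {z : ℂ}
    (hz : IsWeyl (shift (opMatrix A B C) z)) : IsWeyl (shift (opMatrix A B 0) z) := by
  by_contra hw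
  have hw' : z ∈ weylSpectrum (opMatrix A B 0) := hw
  rw [shift_opMatrix] at hz hw
  have hAu := isUpperSemiFredholm_left C hz.1
  obtain ⟨⟨-, hMk⟩, ⟨-, hMc⟩, hind⟩ := hz
  have hBc := finiteDimensional_coker_right (A := shift A z) (B := shift B z) C
  have hAk := hAu.2
  have hAz : z ∈ weylSpectrum (opMatrix A B 0) \ upperSemiFredholmSpectrum A :=
    ⟨hw', fun h => h hAu⟩
  have hBz : z ∈ weylSpectrum (opMatrix A B 0) \ lowerSemiFredholmSpectrum B :=
    ⟨hw', fun h => h ⟨isClosed_range_of_finiteDimensional_coker _, hBc⟩⟩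
  rcases hSVEP with h | h | h
  · have hBk := (h.2 z hBz).finrank_ker_le.1
    have hAc := finiteDimensional_coker_left (A := shift A z) (B := shift B z) C
    exact hw (isWeyl_opMatrix_of_fredholm C 0 hind)
  · have hAc := ((h z hAz).2.finrank_coker_le hAu.1).1
    have hBk := finiteDimensional_ker_right (A := shift A z) (B := shift B z) C
    exact hw (isWeyl_opMatrix_of_fredholm C 0 hind)
  · have hAc := ((h.1 z hAz).finrank_coker_le hAu.1).1
    have hBk := finiteDimensional_ker_right (A := shift A z) (B := shift B z) C
    exact hw (isWeyl_opMatrix_of_fredholm C 0 hind)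

theorem isWeyl_opMatrix_of_zero {z : ℂ} (h : IsWeyl (shift (opMatrix A B 0) z)) :
    IsWeyl (shift (opMatrix A B C) z) := by
  rw [shift_opMatrix] at h ⊢
  obtain ⟨⟨_, _⟩, _, _⟩ := h.finiteDimensional_of_opMatrix_zero
  exact isWeyl_opMatrix_of_fredholm 0 C h.2.2

theorem notMem_spectrum_opMatrix {z : ℂ} (hA : z ∉ spectrum ℂ A) (hB : z ∉ spectrum ℂ B) :
    z ∉ spectrum ℂ (opMatrix A B C) := by
  rw [notMem_spectrum_iff] at *
  rw [shift_opMatrix]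
  exact bijective_opMatrix C hA hB

theorem notMem_spectrum_of_opMatrix_zero {z : ℂ} (h : z ∉ spectrum ℂ (opMatrix A B 0)) :
    z ∉ spectrum ℂ A ∧ z ∉ spectrum ℂ B := by
  simp only [notMem_spectrum_iff] at *
  rw [shift_opMatrix] at h
  exact bijective_of_bijective_opMatrix_zero h

/-- Invertibility of `M_C - z` only gives `A - z` injective and `B - z` surjective. If `z ∈ σ(M_0)`,
Weyl's theorem for `M_0` makes `z` isolated there, so both entries have index zero and are
bijective, a contradiction. -/
theorem spectrum_opMatrix_eq (hSVEP : SVEPHypI A B ∨ SVEPHypII A B ∨ SVEPHypIII A B)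
    (h₀ : SatisfiesWeyl (opMatrix A B 0)) :
    spectrum ℂ (opMatrix A B C) = spectrum ℂ (opMatrix A B 0) := by
  refine Subset.antisymm (fun z hz => ?_) fun z hz => ?_
  · by_contra h
    obtain ⟨hA, hB⟩ := notMem_spectrum_of_opMatrix_zero h
    exact notMem_spectrum_opMatrix C hA hB hz
  · by_contra h
    have hb := notMem_spectrum_iff.1 h
    have hw := isWeyl_opMatrix_zero C hSVEP (isWeyl_of_bijective hb)
    have hpi : z ∈ piZero (opMatrix A B 0) := h₀ ▸ ⟨hz, notMem_weylSpectrum.2 hw⟩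
    have hiso := (mem_isoSpectrum_iff.1 hpi.1).2
    rw [shift_opMatrix] at hb hw
    obtain ⟨⟨hAk, hAc⟩, hBk, hBc⟩ := hw.finiteDimensional_of_opMatrix_zero
    have hA := (index_eq_zero_and_polaroidAt
      (hiso.mono fun w hw => (notMem_spectrum_of_opMatrix_zero hw).1)).1
    have hB := (index_eq_zero_and_polaroidAt
      (hiso.mono fun w hw => (notMem_spectrum_of_opMatrix_zero hw).2)).1
    have hAb := (isWeyl_iff.2 ⟨hAk, hAc, hA⟩).bijective_of_injective
      (injective_left_of_injective C hb.1)
    have hBb := (isWeyl_iff.2 ⟨hBk, hBc, hB⟩).bijective_of_surjective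
      (surjective_right_of_surjective C hb.2)
    exact notMem_spectrum_opMatrix 0 (notMem_spectrum_iff.2 hAb) (notMem_spectrum_iff.2 hBb) hz

theorem weylSpectrum_opMatrix_eq (hSVEP : SVEPHypI A B ∨ SVEPHypII A B ∨ SVEPHypIII A B) :
    weylSpectrum (opMatrix A B C) = weylSpectrum (opMatrix A B 0) := by
  ext z
  exact not_congr ⟨isWeyl_opMatrix_zero C hSVEP, isWeyl_opMatrix_of_zero C⟩

theorem mem_isoSpectrum_opMatrix_iff (hSVEP : SVEPHypI A B ∨ SVEPHypII A B ∨ SVEPHypIII A B)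
    (h₀ : SatisfiesWeyl (opMatrix A B 0)) {z : ℂ} :
    z ∈ isoSpectrum (opMatrix A B C) ↔ z ∈ isoSpectrum (opMatrix A B 0) := by
  simp only [isoSpectrum, spectrum_opMatrix_eq C hSVEP h₀]

theorem eventually_notMem_spectrum_left
    (hSVEP : SVEPHypI A B ∨ SVEPHypII A B ∨ SVEPHypIII A B)
    (h₀ : SatisfiesWeyl (opMatrix A B 0)) {z : ℂ} (hz : z ∈ piZero (opMatrix A B C)) :
    ∀ᶠ w in 𝓝[≠] z, w ∉ spectrum ℂ A :=
  (mem_isoSpectrum_iff.1 ((mem_isoSpectrum_opMatrix_iff C hSVEP h₀).1 hz.1)).2.mono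
    fun _ hw => (notMem_spectrum_of_opMatrix_zero hw).1

theorem satisfiesWeyl_opMatrix (hSVEP : SVEPHypI A B ∨ SVEPHypII A B ∨ SVEPHypIII A B)
    (h₀ : SatisfiesWeyl (opMatrix A B 0))
    (hpol : ∀ z ∈ piZero (opMatrix A B C), PolaroidAt A z) :
    SatisfiesWeyl (opMatrix A B C) := by
  have h₀' : spectrum ℂ (opMatrix A B 0) \ weylSpectrum (opMatrix A B 0) =
    piZero (opMatrix A B 0) := h₀
  rw [SatisfiesWeyl, weylSpectrum_opMatrix_eq C hSVEP]
  refine Subset.antisymm (fun z hz => ?_) fun z hz => ?_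
  · have hw := isWeyl_opMatrix_of_zero C (notMem_weylSpectrum.1 hz.2)
    refine ⟨?_, fun hk => ?_, hw.1.2⟩
    · rw [spectrum_opMatrix_eq C hSVEP h₀, h₀'] at hz
      exact (mem_isoSpectrum_opMatrix_iff C hSVEP h₀).2 hz.1
    · exact notMem_spectrum_iff.2 (hw.bijective_of_injective (LinearMap.ker_eq_bot.1 hk)) hz.1
  · rw [spectrum_opMatrix_eq C hSVEP h₀, h₀']
    have hA := hpol z hz
    obtain ⟨hiso, hne, hfin⟩ := hz
    rw [shift_opMatrix] at hne hfin
    refine ⟨(mem_isoSpectrum_opMatrix_iff C hSVEP h₀).1 hiso, ?_, ?_⟩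
    · rw [shift_opMatrix]
      exact ker_opMatrix_ne_bot_of_ne_bot C hne
    · rw [shift_opMatrix]
      have hAk := finiteDimensional_ker_left (A := shift A z) (B := shift B z) C
      -- Finite descent bounds `coker (A - z)`, and exactness at `ker (B - z)` then bounds that
      -- kernel.
      have hAc := hA.finiteDimensional_coker
      have hBk := finiteDimensional_ker_right (A := shift A z) (B := shift B z) C
      exact finiteDimensional_ker_opMatrix 0

theorem polaroidAt_left_of_satisfiesWeyl
    (hSVEP : SVEPHypI A B ∨ SVEPHypII A B ∨ SVEPHypIII A B)
    (h₀ : SatisfiesWeyl (opMatrix A B 0)) (hC : SatisfiesWeyl (opMatrix A B C)) {z : ℂ}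
    (hz : z ∈ piZero (opMatrix A B C)) : PolaroidAt A z := by
  have hev := eventually_notMem_spectrum_left C hSVEP h₀ hz
  rw [← (hC : _ = piZero _)] at hz
  have hw := isWeyl_opMatrix_zero C hSVEP (notMem_weylSpectrum.1 hz.2)
  rw [shift_opMatrix] at hw
  obtain ⟨⟨_, _⟩, -, -⟩ := hw.finiteDimensional_of_opMatrix_zero
  exact (index_eq_zero_and_polaroidAt hev).2

/-- Such a `z` is isolated in `σ(A)` or outside it. In the isolated case, if `A` is isoloid, then `z
∈ π₀(A)`, and Weyl's theorem for `A` makes `A - z` Fredholm. -/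
theorem polaroidAt_left_of_polaroid_or_isoloid
    (hSVEP : SVEPHypI A B ∨ SVEPHypII A B ∨ SVEPHypIII A B)
    (h₀ : SatisfiesWeyl (opMatrix A B 0)) (hA : Polaroid A ∨ (Isoloid A ∧ SatisfiesWeyl A)) {z : ℂ}
    (hz : z ∈ piZero (opMatrix A B C)) : PolaroidAt A z := by
  have hev := eventually_notMem_spectrum_left C hSVEP h₀ hz
  by_cases hzA : z ∈ spectrum ℂ A
  · have hiso : z ∈ isoSpectrum A := mem_isoSpectrum_iff.2 ⟨hzA, hev⟩
    rcases hA with hA | ⟨hA, hAW⟩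
    · exact hA z hiso
    · have hfin := hz.2.2
      rw [shift_opMatrix] at hfin
      have hAk := finiteDimensional_ker_left (A := shift A z) (B := shift B z) C
      have hpi : z ∈ piZero A := ⟨hiso, hA z hiso, hAk⟩
      rw [← (hAW : _ = piZero _)] at hpi
      have := (notMem_weylSpectrum.1 hpi.2).2.1.2
      exact (index_eq_zero_and_polaroidAt hev).2
  · exact polaroidAt_of_notMem_spectrum hzA

end Weyl

end WeylOp

open WeylOp

theorem mainTheorem1 {X : Type*} [NormedAddCommGroup X] [NormedSpace ℂ X] [CompleteSpace X]
    (A B : X →L[ℂ] X) (hSVEP : SVEPHypI A B ∨ SVEPHypII A B ∨ SVEPHypIII A B) :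
    ((∀ C : X →L[ℂ] X, SatisfiesWeyl (opMatrix A B C)) ↔
      (SatisfiesWeyl (opMatrix A B 0) ∧
        ∀ C : X →L[ℂ] X, ∀ z ∈ piZero (opMatrix A B C), PolaroidAt A z)) ∧
    (SatisfiesWeyl (opMatrix A B 0) → ∀ C : X →L[ℂ] X,
      (∀ z ∈ piZero (opMatrix A B C), PolaroidAt A z) → SatisfiesWeyl (opMatrix A B C)) ∧
    (SatisfiesWeyl (opMatrix A B 0) → (Polaroid A ∨ (Isoloid A ∧ SatisfiesWeyl A)) →
      ∀ C : X →L[ℂ] X, SatisfiesWeyl (opMatrix A B C)) := by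
  refine ⟨⟨fun h => ⟨h 0, fun C z hz => ?_⟩, fun h C => ?_⟩, fun h₀ C hpol => ?_,
    fun h₀ hA C => ?_⟩
  · exact polaroidAt_left_of_satisfiesWeyl C hSVEP (h 0) (h C) hz
  · exact satisfiesWeyl_opMatrix C hSVEP h.1 (h.2 C)
  · exact satisfiesWeyl_opMatrix C hSVEP h₀ hpol
  · exact satisfiesWeyl_opMatrix C hSVEP h₀ fun z hz =>
      polaroidAt_left_of_polaroid_or_isoloid C hSVEP h₀ hA hz
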